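/- Let $C$ be a commutative Noetherian ring of finite Krull dimension $\dim C = D$, let $n \ge 0$, and let $A = C[x_1,\dots,x_n]$. Let $r \ge \max(3, D+2)$. Index the coordinates of $A^{2r}$ by $1,\dots,r,-r,\dots,-1$ and those of $A^{2r+1}$ by $1,\dots,r,0,-r,\dots,-1$, and put $q(x)=\sum_{i=1}^r x_i x_{-i}$ on $A^{2r}$ and $q(x)=x_0^2+\sum_{i=1}^r x_i x_{-i}$ on $A^{2r+1}$. A column is called unimodular if its entries generate the unit ideal. Let $$\mathrm{IUm}_{2r}A=\{b\in A^{2r} : b \text{ is unimodular},\ q(b)=0\},$$ $$\mathrm{IUm}_{2r+1}A=\{b\in A^{2r+1} : (b_1,\dots,b_r,2b_0,b_{-r},\dots,b_{-1}) \text{ is unimodular},\ q(b)=0\}.$$ Let $e$ be the identity matrix and $e_{i,j}$ the matrix units. The elementary orthogonal transvections of size $2r$ are the matrices $T_{i,j}(\xi)=e+\xi e_{i,j}-\xi e_{-j,-i}$ with $\xi\in A$ and $i,j\in\{\pm1,\dots,\pm r\}$, $i\ne\pm j$. Those of size $2r+1$ are the matrices $T_{i,j}(\xi)$ given by the same formula,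 for the same $i,j$ and $\xi$, together with the matrices $T_{i,0}(\xi)=e+2\xi e_{i,0}-\xi e_{0,-i}-\xi^2 e_{i,-i}$ with $\xi\in A$ and $i\in\{\pm1,\dots,\pm r\}$. For $m=2r$ or $m=2r+1$ let $EO(m,A)^{\le N}$ be the set of all products of at most $N$ elementary orthogonal transvections of size $m$. Order the monomials lexicographically: $x_1^{k_1}\cdots x_n^{k_n}$ is bigger than $x_1^{l_1}\cdots x_n^{l_n}$ if for some $m$ we have $k_i=l_i$ for $i<m$ and $k_m>l_m$. A polynomial in $A$ is called lexicographically monic if its leading coefficient with respect to this order is $1$. Then for every $b\in\mathrm{IUm}_{2r}A$ there is a column $b'\in EO(2r,A)^{\le 11r-7}\,b$ whose entry $b'_{-2}$ is lexicographically monic, and for every $b\in\mathrm{IUm}_{2r+1}A$ there is a column $b'\in EO(2r+1,A)^{\le 12r-8}\,b$ whose entry $b'_{-2}$ is lexicographically monic. -/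

import Mathlib

open scoped Matrix

namespace SplitOrthogonal

/-- The indices `1, …, r, -r, …, -1` of the even split orthogonal group of rank `2r`:
`Sum.inl i` is the positive index `i + 1` and `Sum.inr i` is the negative index `-(i + 1)`. -/
abbrev EvenIdx (r : ℕ) : Type := Fin r ⊕ Fin r

/-- The indices `1, …, r, 0, -r, …, -1` of the odd split orthogonal group of rank `2r + 1`:
`none` is the index `0` and `some i` is the nonzero index `i`. -/
abbrev OddIdx (r : ℕ) : Type := Option (EvenIdx r)

/-- The index `-i`. -/
abbrev negIdx {r : ℕ} (i : EvenIdx r) : EvenIdx r := i.swap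

/-- The negative index `-k`, for `1 ≤ k ≤ r`. -/
def minus {r : ℕ} (k : ℕ) (hk : 1 ≤ k ∧ k ≤ r) : EvenIdx r :=
  Sum.inr ⟨k - 1, by omega⟩

/-- A column is unimodular if its entries generate the unit ideal. -/
def IsUnimodular {ι R : Type*} [CommRing R] (b : ι → R) : Prop :=
  Ideal.span (Set.range b) = ⊤

section Even

variable {R : Type*} [CommRing R]

/-- The even split quadratic form `∑ i, x_i x_{-i}` on `R ^ (2r)`. -/
def evenForm {r : ℕ} (x : EvenIdx r → R) : R :=
  ∑ i : Fin r, x (Sum.inl i) * x (Sum.inr i)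

/-- The matrix `T_{i,j}(ξ) = e + ξ e_{i,j} - ξ e_{-j,-i}` of size `2r`. -/
def evenT {r : ℕ} (i j : EvenIdx r) (ξ : R) : Matrix (EvenIdx r) (EvenIdx r) R :=
  1 + Matrix.single i j ξ - Matrix.single (negIdx j) (negIdx i) ξ

/-- Elementary orthogonal transvections of size `2r`: the `T_{i,j}(ξ)` with `i ≠ ±j`. -/
def IsEvenTransvection {r : ℕ} (g : Matrix (EvenIdx r) (EvenIdx r) R) : Prop :=
  ∃ (i j : EvenIdx r) (ξ : R), i ≠ j ∧ i ≠ negIdx j ∧ g = evenT i j ξ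

variable (R) in
/-- `EO(2r, R)^{≤ N}`: products of at most `N` elementary orthogonal transvections. -/
def evenEOLe (r N : ℕ) : Set (Matrix (EvenIdx r) (EvenIdx r) R) :=
  {g | ∃ l : List (Matrix (EvenIdx r) (EvenIdx r) R),
    l.length ≤ N ∧ (∀ t ∈ l, IsEvenTransvection t) ∧ g = l.prod}

variable (R) in
/-- The isotropic unimodular columns of height `2r`. -/
def evenIUm (r : ℕ) : Set (EvenIdx r → R) :=
  {b | IsUnimodular b ∧ evenForm b = 0}

end Even

section Odd

variable {R : Type*} [CommRing R]

/-- The odd split quadratic form `x_0 ^ 2 + ∑ i, x_i x_{-i}` on `R ^ (2r + 1)`. -/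
def oddForm {r : ℕ} (x : OddIdx r → R) : R :=
  x none ^ 2 + ∑ i : Fin r, x (some (Sum.inl i)) * x (some (Sum.inr i))

/-- The matrix `T_{i,j}(ξ) = e + ξ e_{i,j} - ξ e_{-j,-i}` of size `2r + 1`. -/
def oddLongT {r : ℕ} (i j : EvenIdx r) (ξ : R) : Matrix (OddIdx r) (OddIdx r) R :=
  1 + Matrix.single (some i) (some j) ξ - Matrix.single (some (negIdx j)) (some (negIdx i)) ξ

/-- The matrix `T_{i,0}(ξ) = e + 2ξ e_{i,0} - ξ e_{0,-i} - ξ² e_{i,-i}` of size `2r + 1`. -/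
def oddShortT {r : ℕ} (i : EvenIdx r) (ξ : R) : Matrix (OddIdx r) (OddIdx r) R :=
  1 + Matrix.single (some i) none (2 * ξ) - Matrix.single none (some (negIdx i)) ξ
    - Matrix.single (some i) (some (negIdx i)) (ξ ^ 2)

/-- Elementary orthogonal transvections of size `2r + 1`: the long root transvections `T_{i,j}(ξ)`
with `i ≠ ±j`, and the short root transvections `T_{i,0}(ξ)`. -/
def IsOddTransvection {r : ℕ} (g : Matrix (OddIdx r) (OddIdx r) R) : Prop :=
  (∃ (i j : EvenIdx r) (ξ : R), i ≠ j ∧ i ≠ negIdx j ∧ g = oddLongT i j ξ) ∨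
    ∃ (i : EvenIdx r) (ξ : R), g = oddShortT i ξ

variable (R) in
/-- `EO(2r + 1, R)^{≤ N}`: products of at most `N` elementary orthogonal transvections. -/
def oddEOLe (r N : ℕ) : Set (Matrix (OddIdx r) (OddIdx r) R) :=
  {g | ∃ l : List (Matrix (OddIdx r) (OddIdx r) R),
    l.length ≤ N ∧ (∀ t ∈ l, IsOddTransvection t) ∧ g = l.prod}

/-- The column `b` with its middle entry `b_0` replaced by `2 b_0`. -/
def doubleMiddle {r : ℕ} (b : OddIdx r → R) : OddIdx r → R
  | none => 2 * b none
  | some i => b (some i)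

variable (R) in
/-- The columns `b` of height `2r + 1` that are isotropic and stay unimodular
when `b_0` is replaced by `2 b_0`. -/
def oddIUm (r : ℕ) : Set (OddIdx r → R) :=
  {b | IsUnimodular (doubleMiddle b) ∧ oddForm b = 0}

end Odd

/-- A polynomial in `x_1, …, x_n` (the variables `X 0, …, X (n - 1)`) is lexicographically monic if
its leading coefficient, for the lexicographic order with `x_1 > x_2 > … > x_n`, is one. -/
def IsLexMonic {C : Type*} [CommRing C] {n : ℕ} (f : MvPolynomial (Fin n) C) : Prop :=
  (MonomialOrder.lex (σ := Fin n)).Monic f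

end SplitOrthogonal

/-!
Let `u` be the positive and `v` the negative half of a unimodular column, and fix `k`. A general
position argument with Eichler transvections moves the column, in `3 (r - 1)` elementary steps, to
one where the `u i` with `i ≠ k` generate an ideal of height at least `r - 1 > dim C`. Passing to
the ideal of leading coefficients of a polynomial ring does not lower the height, so by induction on
the number of variables such an ideal contains a lexicographically monic polynomial. Multiplied by a
large monomial, it can be added to `v k` in `r - 1` further steps. An odd column reduces to the even
one without its middle entry `b_0`: by isotropy `b_0 ^ 2` lies in the ideal of the other entries, so
these are already unimodular.
-/

namespace SplitOrthogonal

section Height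

open Polynomial

variable {R : Type*} [CommRing R]

theorem exists_isPrime_leadingCoeff_le (I : Ideal R[X]) (Q : Ideal R) [hQ : Q.IsPrime]
    (hIQ : I.leadingCoeff ≤ Q) :
    ∃ P : Ideal R[X], P.IsPrime ∧ I ≤ P ∧ P.leadingCoeff ≤ Q := by
  have : Nontrivial R := nontrivial_of_ne 1 0 fun h => hQ.one_notMem (h ▸ Q.zero_mem)
  let S : Submonoid R[X] :=
    { carrier := {f | f.leadingCoeff ∉ Q}
      one_mem' := by simpa using hQ.one_notMem
      mul_mem' := fun {f g} hf hg => by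
        have hfg : f.leadingCoeff * g.leadingCoeff ∉ Q := hQ.mul_notMem hf hg
        rwa [← leadingCoeff_mul' fun h => hfg (h ▸ Q.zero_mem)] at hfg }
  have hIS : Disjoint (I : Set R[X]) S := Set.disjoint_left.2 fun f hf hfS =>
    hfS (hIQ ((I.mem_leadingCoeff _).2 ⟨f, hf, rfl⟩))
  obtain ⟨P, hP, hIP, hPS⟩ := Ideal.exists_le_prime_disjoint I S hIS
  refine ⟨P, hP, hIP, fun a ha => ?_⟩
  obtain ⟨f, hf, rfl⟩ := (P.mem_leadingCoeff a).1 ha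
  exact not_not.1 (Set.disjoint_left.1 hPS hf)

variable [IsNoetherianRing R]

attribute [local instance] Polynomial.algebra Polynomial.isLocalization in
theorem height_le_height_comap_C_add_one (P : Ideal R[X]) [P.IsPrime] :
    P.height ≤ (P.comap C).height + 1 := by
  set p := P.comap C
  let Rp := Localization.AtPrime p
  have hdisj : Disjoint (p.primeCompl.map C : Set R[X]) P :=
    Set.disjoint_left.2 fun _ ⟨_, ha, haf⟩ hf => ha (haf ▸ hf :)
  have hprime : (P.map (algebraMap R[X] Rp[X])).IsPrime :=
    IsLocalization.isPrime_of_isPrime_disjoint (p.primeCompl.map C) _ P ‹_› hdisj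
  have hdim := Ideal.height_le_ringKrullDim_of_isPrime (I := P.map (algebraMap R[X] Rp[X]))
  rw [IsLocalization.height_map_of_disjoint (p.primeCompl.map C) P hdisj,
    ringKrullDim_of_isNoetherianRing, IsLocalization.AtPrime.ringKrullDim_eq_height p Rp] at hdim
  exact_mod_cast hdim

theorem height_map_C_le (p : Ideal R) [p.IsPrime] : (p.map (C : R →+* R[X])).height ≤ p.height := by
  have : (p.map (algebraMap R R[X])).IsPrime := Ideal.isPrime_map_C_of_isPrime
  have : (p.map (algebraMap R R[X])).LiesOver p :=
    ⟨le_antisymm Ideal.le_comap_map fun a ha => by simpa using Ideal.mem_map_C_iff.1 ha 0⟩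
  simpa using Ideal.height_le_height_add_of_liesOver p (p.map (algebraMap R R[X]))

theorem height_le_of_leadingCoeff_le (P : Ideal R[X]) [P.IsPrime] (Q : Ideal R) [Q.IsPrime]
    (hPQ : P.leadingCoeff ≤ Q) : P.height ≤ Q.height := by
  have hle : P.comap C ≤ P.leadingCoeff := fun a ha =>
    (P.mem_leadingCoeff a).2 ⟨C a, ha, leadingCoeff_C a⟩
  rcases hle.eq_or_lt with heq | hlt
  · calc P.height = ((P.comap C).map C).height := by
          rw [P.map_C_comap_of_comap_eq_leadingCoeff heq]
      _ ≤ (P.comap C).height := height_map_C_le _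
      _ ≤ Q.height := Ideal.height_mono (hle.trans hPQ)
  · exact (height_le_height_comap_C_add_one P).trans
      (Ideal.height_add_one_le_of_lt_of_isPrime (hlt.trans_le hPQ))

theorem height_le_height_leadingCoeff (I : Ideal R[X]) : I.height ≤ I.leadingCoeff.height := by
  rw [I.leadingCoeff.height_eq_inf_minimalPrimes]
  refine le_iInf₂ fun Q hQ => ?_
  have := hQ.1.1
  obtain ⟨P, hP, hIP, hPQ⟩ := exists_isPrime_leadingCoeff_le I Q hQ.1.2
  exact (Ideal.height_mono hIP).trans (height_le_of_leadingCoeff_le P Q hPQ)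

end Height

section LexMonic

open MvPolynomial MonomialOrder

variable {C : Type*} [CommRing C] {n : ℕ}

theorem cons_lex_le_cons {i j : ℕ} {s t : Fin n →₀ ℕ} (h : i < j ∨ i = j ∧ s ≼[lex] t) :
    s.cons i ≼[lex] t.cons j := by
  rw [lex_le_iff]
  rcases h with hij | ⟨rfl, hst⟩
  · exact le_of_lt (Finsupp.Lex.lt_iff.2 ⟨0, fun l hl => absurd hl (Fin.not_lt_zero l), by simpa⟩)
  · rcases (lex_le_iff.1 hst).eq_or_lt with heq | hlt
    · rw [toLex.injective heq]
    · obtain ⟨l, heq, hl⟩ := Finsupp.Lex.lt_iff.1 hlt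
      refine le_of_lt (Finsupp.Lex.lt_iff.2 ⟨l.succ, fun m hm => ?_, by simpa using hl⟩)
      cases m using Fin.cases with
      | zero => simp
      | succ m => simpa using heq m (by simpa using hm)

theorem lex_degree_eq_cons (f : MvPolynomial (Fin (n + 1)) C) :
    lex.degree f =
      (lex.degree (finSuccEquiv C n f).leadingCoeff).cons (finSuccEquiv C n f).natDegree := by
  rcases eq_or_ne f 0 with rfl | hf
  · simp
  refine lex.toSyn.injective (le_antisymm (lex.degree_le_iff.2 fun c hc => ?_)
    (lex.le_degree ?_))
  · rw [← c.cons_tail, mem_support_iff, ← finSuccEquiv_coeff_coeff] at hc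
    rw [← c.cons_tail]
    have hdeg : c 0 ≤ (finSuccEquiv C n f).natDegree :=
      Polynomial.le_natDegree_of_ne_zero fun h => hc (by simp [h])
    refine cons_lex_le_cons (hdeg.lt_or_eq.imp_right fun heq => ⟨heq, lex.le_degree ?_⟩)
    rwa [mem_support_iff, Polynomial.leadingCoeff, ← heq]
  · rw [mem_support_iff, ← finSuccEquiv_coeff_coeff]
    exact lex.coeff_degree_ne_zero_iff.2 (by simpa)

theorem lex_leadingCoeff_eq (f : MvPolynomial (Fin (n + 1)) C) :
    lex.leadingCoeff f = lex.leadingCoeff (finSuccEquiv C n f).leadingCoeff := by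
  rw [leadingCoeff, lex_degree_eq_cons, ← finSuccEquiv_coeff_coeff]
  rfl

theorem exists_isLexMonic_mem [IsNoetherianRing C] (I : Ideal (MvPolynomial (Fin n) C))
    (hI : ringKrullDim C < I.height) : ∃ f ∈ I, IsLexMonic f := by
  induction n with
  | zero =>
    have hItop : I = ⊤ := by
      by_contra hne
      have hle := Ideal.height_le_ringKrullDim_of_ne_top hne
      rw [ringKrullDim_eq_of_ringEquiv (isEmptyRingEquiv C (Fin 0))] at hle
      exact hle.not_gt hI
    exact ⟨1, hItop ▸ Submodule.mem_top, monic_one⟩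
  | succ n ih =>
    let e := (finSuccEquiv C n).toRingEquiv
    have hheight : I.height ≤ (I.map e).leadingCoeff.height :=
      (e.height_map I).ge.trans (height_le_height_leadingCoeff _)
    obtain ⟨_, hlc, hmonic⟩ := ih (I.map e).leadingCoeff
      (hI.trans_le (WithBot.coe_le_coe.2 hheight))
    obtain ⟨_, hq, rfl⟩ := (Ideal.mem_leadingCoeff _ _).1 hlc
    obtain ⟨f, hf, rfl⟩ := (Ideal.mem_map_of_equiv e _).1 hq
    exact ⟨f, hf, (lex_leadingCoeff_eq f).trans hmonic⟩

theorem exists_add_monic {σ : Type*} {m : MonomialOrder σ} {I : Ideal (MvPolynomial σ C)}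
    {f : MvPolynomial σ C} (hfI : f ∈ I) (hf : m.Monic f) (g : MvPolynomial σ C) :
    ∃ h ∈ I, m.Monic (g + h) := by
  classical
  nontriviality C
  rcases isEmpty_or_nonempty σ with _ | ⟨⟨i⟩⟩
  · have hf1 : f = 1 := by
      rw [m.eq_C_of_degree_eq_zero (Subsingleton.elim (m.degree f) 0), hf.leadingCoeff_eq_one, C_1]
    exact ⟨1 - g, I.eq_top_of_isUnit_mem hfI (hf1 ▸ isUnit_one) ▸ Submodule.mem_top,
      by simp⟩
  · let e : σ →₀ ℕ := m.degree g + Finsupp.single i 1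
    have he : m.Monic (monomial e (1 : C)) := monic_monomial_one
    refine ⟨monomial e 1 * f, I.mul_mem_left _ hfI, add_comm g _ ▸ (he.mul hf).add_of_lt ?_⟩
    have hdeg : m.degree (monomial e (1 : C) * f) = e + m.degree f := by
      rw [degree_mul_of_isRegular_right he.ne_zero (hf.leadingCoeff_eq_one ▸ isRegular_one),
        degree_monomial, if_neg one_ne_zero]
    calc m.toSyn (m.degree g) < m.toSyn e := by
          rw [map_add]
          exact lt_add_of_pos_right _ (m.toSyn_lt_iff_ne_zero.2 (by simp))
      _ ≤ m.toSyn (m.degree (monomial e (1 : C) * f)) := by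
          rw [hdeg, map_add m.toSyn e]
          exact m.le_add_right e _

end LexMonic

section GeneralPosition

variable {A : Type*} [CommRing A]

theorem exists_forall_add_mul_notMem (a s : A) (M : Finset (Ideal A)) (hM : ∀ P ∈ M, P.IsPrime)
    (hs : ∀ P ∈ M, s ∉ P) : ∃ t, ∀ P ∈ M, a + s * t ∉ P := by
  classical
  -- `t` must avoid the primes containing `a` and lie in the others; a prime contained in one that
  -- contains `a` needs no separate treatment.
  let F := {P ∈ M | ∀ Q ∈ M, a ∈ Q → ¬ P ≤ Q}
  obtain ⟨t, htF, ht⟩ : ∃ t ∈ ∏ P ∈ F, P, ∀ Q ∈ M, a ∈ Q → t ∉ Q := by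
    by_contra! hcover
    obtain ⟨Q, hQ, hle⟩ := (Ideal.subset_union_prime (s := {Q ∈ M | a ∈ Q}) (f := id) ⊤ ⊤
      fun Q hQ _ _ => hM Q (Finset.mem_of_mem_filter Q hQ)).1 fun t ht => by
        simpa [and_assoc] using hcover t ht
    rw [Finset.mem_filter] at hQ
    obtain ⟨P, hP, hPQ⟩ := ((hM Q hQ.1).prod_le (f := id)).1 hle
    exact (Finset.mem_filter.1 hP).2 Q hQ.1 hQ.2 hPQ
  refine ⟨t, fun P hP hmem => ?_⟩
  by_cases hPF : P ∈ F
  · have htP : t ∈ P := Finset.inf_le (f := id) hPF (Ideal.prod_le_inf htF)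
    exact (Finset.mem_filter.1 hPF).2 P hP
      ((Submodule.add_mem_iff_left P (P.mul_mem_left s htP)).1 hmem) le_rfl
  · obtain ⟨Q, hQ, haQ, hPQ⟩ : ∃ Q ∈ M, a ∈ Q ∧ P ≤ Q := by simpa [F, hP] using hPF
    have hst : s * t ∈ Q := (Submodule.add_mem_iff_right Q haQ).1 (hPQ hmem)
    exact ((hM Q hQ).mem_or_mem hst).elim (hs Q hQ) (ht Q hQ haQ)

theorem exists_forall_card_le_height [IsNoetherianRing A] {ι : Type*} (S : Finset ι) (a : ι → A)
    (s : A) :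
    ∃ t : ι → A, (∀ i ∉ S, t i = 0) ∧ ∀ P : Ideal A, P.IsPrime →
      (∀ i ∈ S, a i + s * t i ∈ P) → s ∉ P → (S.card : ℕ∞) ≤ P.height := by
  classical
  induction S using Finset.induction with
  | empty => exact ⟨0, by simp, by simp⟩
  | insert k S hk ih =>
    obtain ⟨t, ht0, ht⟩ := ih
    let I : Ideal A := Ideal.span ((fun i => a i + s * t i) '' S)
    have hI : ∀ P : Ideal A, I ≤ P ↔ ∀ i ∈ S, a i + s * t i ∈ P := fun P => by
      simp [I, Ideal.span_le, Set.subset_def]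
    obtain ⟨c, hc⟩ := exists_forall_add_mul_notMem (a k) s
      {P ∈ I.finite_minimalPrimes_of_isNoetherianRing.toFinset | s ∉ P}
      (fun P hP => ((Set.Finite.mem_toFinset _).1 (Finset.mem_filter.1 hP).1).1.1)
      (fun P hP => (Finset.mem_filter.1 hP).2)
    refine ⟨Function.update t k c, fun i hi => ?_, fun P hP hmem hs => ?_⟩
    · rw [Finset.mem_insert, not_or] at hi
      rw [Function.update_of_ne hi.1, ht0 i hi.2]
    · have hIP : I ≤ P := (hI P).2 fun i hi => by
        simpa [ne_of_mem_of_not_mem hi hk] using hmem i (Finset.mem_insert_of_mem hi)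
      have hkP : a k + s * c ∈ P := by simpa using hmem k (Finset.mem_insert_self k S)
      obtain ⟨Q, hQ, hQP⟩ := Ideal.exists_minimalPrimes_le hIP
      have hsQ : s ∉ Q := fun h => hs (hQP h)
      have := hQ.1.1
      have hlt : Q < P := hQP.lt_of_ne fun h => hc Q (by simp [hQ, hsQ]) (h ▸ hkP)
      calc ((insert k S).card : ℕ∞) = S.card + 1 := by simp [hk]
        _ ≤ Q.height + 1 := by gcongr; exact ht Q hQ.1.1 ((hI Q).1 hQ.1.2) hsQ
        _ ≤ P.height := Ideal.height_add_one_le_of_lt_of_isPrime hlt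

end GeneralPosition

section Orbit

variable {R : Type*} [CommRing R] {r : ℕ}

theorem evenEOLe_mono {M N : ℕ} (h : M ≤ N) : evenEOLe R r M ⊆ evenEOLe R r N :=
  fun _ ⟨l, hl, ht, hg⟩ => ⟨l, hl.trans h, ht, hg⟩

theorem oddEOLe_mono {M N : ℕ} (h : M ≤ N) : oddEOLe R r M ⊆ oddEOLe R r N :=
  fun _ ⟨l, hl, ht, hg⟩ => ⟨l, hl.trans h, ht, hg⟩

/-- The columns obtained from `x` by at most `N` elementary orthogonal transvections of size
`2r`. -/
def evenOrbitLe (N : ℕ) (x : EvenIdx r → R) : Set (EvenIdx r → R) :=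
  (fun g => g *ᵥ x) '' evenEOLe R r N

theorem self_mem_evenOrbitLe (x : EvenIdx r → R) : x ∈ evenOrbitLe 0 x :=
  ⟨1, ⟨[], by simp⟩, Matrix.one_mulVec x⟩

theorem evenT_mulVec_mem_evenOrbitLe {i j : EvenIdx r} (hij : i ≠ j) (hij' : i ≠ negIdx j) (ξ : R)
    (x : EvenIdx r → R) : evenT i j ξ *ᵥ x ∈ evenOrbitLe 1 x :=
  ⟨_, ⟨[evenT i j ξ], by simpa using ⟨i, j, ξ, hij, hij', rfl⟩⟩, rfl⟩

theorem evenOrbitLe_trans {M N : ℕ} {x y z : EvenIdx r → R} (hy : y ∈ evenOrbitLe M x)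
    (hz : z ∈ evenOrbitLe N y) : z ∈ evenOrbitLe (M + N) x := by
  obtain ⟨_, ⟨l, hl, hlT, rfl⟩, rfl⟩ := hy
  obtain ⟨_, ⟨l', hl', hlT', rfl⟩, rfl⟩ := hz
  refine ⟨_, ⟨l' ++ l, ?_, fun t ht => (List.mem_append.1 ht).elim (hlT' t) (hlT t), rfl⟩, ?_⟩
  · rw [List.length_append, add_comm]
    exact add_le_add hl hl'
  · simp only [List.prod_append, Matrix.mulVec_mulVec]

end Orbit

section Eichler

variable {R : Type*} [CommRing R] {r : ℕ}

/-- The value at `x` of the Eichler (Siegel–Dickson) transvection attached to the basis vector with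
index `-κ` and a vector `t` orthogonal to it. It packs a product of commuting `T_{i,κ}(t i)` into
one formula. The quadratic term of the usual formula is left out, so `t` should be isotropic. -/
def eichler (κ : EvenIdx r) (t x : EvenIdx r → R) : EvenIdx r → R :=
  x + x κ • t - Pi.single (negIdx κ) (t ⬝ᵥ (x ∘ negIdx))

theorem evenT_mulVec (i j : EvenIdx r) (ξ : R) (x : EvenIdx r → R) :
    evenT i j ξ *ᵥ x = eichler j (Pi.single i ξ) x := by
  ext m
  simp [evenT, eichler, Matrix.sub_mulVec, Matrix.add_mulVec, Matrix.single_mulVec,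
    Function.update_apply, Pi.single_apply, mul_comm]

theorem eichler_eichler {κ : EvenIdx r} {s t : EvenIdx r → R} (hs : s κ = 0) (ht : t κ = 0)
    (hst : s ⬝ᵥ (t ∘ negIdx) = 0) (x : EvenIdx r → R) :
    eichler κ s (eichler κ t x) = eichler κ (t + s) x := by
  have hκ : κ ≠ negIdx κ := by cases κ <;> simp
  have hxκ : eichler κ t x κ = x κ := by simp [eichler, ht, hκ]
  have hneg : eichler κ t x ∘ negIdx =
      x ∘ negIdx + x κ • (t ∘ negIdx) - Pi.single κ (t ⬝ᵥ (x ∘ negIdx)) := by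
    ext m
    simp [eichler, Pi.single_apply, Sum.swap_leftInverse.injective.eq_iff]
  have hdot : s ⬝ᵥ (eichler κ t x ∘ negIdx) = s ⬝ᵥ (x ∘ negIdx) := by
    simp [hneg, dotProduct_sub, dotProduct_add, hst, hs]
  rw [eichler, hxκ, hdot]
  simp only [eichler, add_dotProduct, Pi.single_add, smul_add]
  abel

theorem eichler_mem_evenOrbitLe {κ : EvenIdx r} {S : Finset (EvenIdx r)}
    (hS : ∀ i ∈ S, i ≠ κ ∧ i ≠ negIdx κ ∧ negIdx i ∉ S) {t : EvenIdx r → R}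
    (ht : ∀ i ∉ S, t i = 0) (x : EvenIdx r → R) : eichler κ t x ∈ evenOrbitLe S.card x := by
  induction S using Finset.induction generalizing t with
  | empty =>
    obtain rfl : t = 0 := funext fun i => ht i (Finset.notMem_empty i)
    simpa [eichler] using self_mem_evenOrbitLe x
  | insert k S hk ih =>
    obtain ⟨hkκ, hkκ', hknot⟩ := hS k (Finset.mem_insert_self k S)
    let t' := Function.update t k 0
    have ht' : ∀ i ∉ S, t' i = 0 := fun i hi => by
      by_cases hik : i = k
      · simp [t', hik]
      · simp [t', hik, ht i (by simp [hik, hi])]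
    have hκS : κ ∉ S := fun h => (hS κ (Finset.mem_insert_of_mem h)).1 rfl
    have hmem : eichler κ t' x ∈ evenOrbitLe S.card x := ih (fun i hi =>
      have h := hS i (Finset.mem_insert_of_mem hi)
      ⟨h.1, h.2.1, fun hn => h.2.2 (Finset.mem_insert_of_mem hn)⟩) ht'
    have hsplit : evenT k κ (t k) *ᵥ eichler κ t' x = eichler κ t x := by
      rw [evenT_mulVec, eichler_eichler (by simp [hkκ.symm]) (ht' κ hκS)
        (by simp [ht' _ fun h => hknot (Finset.mem_insert_of_mem h)])]
      congr 1
      ext i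
      by_cases hik : i = k
      · simp [t', hik]
      · simp [t', hik]
    rw [Finset.card_insert_of_notMem hk, ← hsplit]
    exact evenOrbitLe_trans hmem (evenT_mulVec_mem_evenOrbitLe hkκ hkκ' _ _)

variable {k : Fin r} {t : Fin r → R}

theorem elim_add_smul_sub_mem_evenOrbitLe (ht : t k = 0) (u v : Fin r → R) :
    Sum.elim (u + v k • t - Pi.single k (t ⬝ᵥ v)) v ∈ evenOrbitLe (r - 1) (Sum.elim u v) := by
  have h := eichler_mem_evenOrbitLe (κ := Sum.inr k) (t := Sum.elim t 0)
    (S := (Finset.univ.erase k).map .inl) (by simp) (by simpa using ht) (Sum.elim u v)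
  convert h using 1
  · simp
  · ext (m | m) <;> simp [eichler, Pi.single_apply, dotProduct, Fintype.sum_sum_type]

theorem elim_add_smul_mem_evenOrbitLe (ht : t k = 0) (u v : Fin r → R) :
    Sum.elim (u + u k • t) (v - Pi.single k (t ⬝ᵥ v)) ∈ evenOrbitLe (r - 1) (Sum.elim u v) := by
  have h := eichler_mem_evenOrbitLe (κ := Sum.inl k) (t := Sum.elim t 0)
    (S := (Finset.univ.erase k).map .inl) (by simp) (by simpa using ht) (Sum.elim u v)
  convert h using 1
  · simp
  · ext (m | m) <;> simp [eichler, Pi.single_apply, dotProduct, Fintype.sum_sum_type]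

theorem elim_neg_add_smul_sub_mem_evenOrbitLe (ht : t k = 0) (u v : Fin r → R) :
    Sum.elim u (v + u k • t - Pi.single k (t ⬝ᵥ u)) ∈ evenOrbitLe (r - 1) (Sum.elim u v) := by
  have h := eichler_mem_evenOrbitLe (κ := Sum.inl k) (t := Sum.elim 0 t)
    (S := (Finset.univ.erase k).map .inr) (by simp) (by simpa using ht) (Sum.elim u v)
  convert h using 1
  · simp
  · ext (m | m) <;> simp [eichler, Pi.single_apply, dotProduct, Fintype.sum_sum_type]

end Eichler

section Unimodular

variable {R : Type*} [CommRing R]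

theorem isUnimodular_iff_forall_isPrime {ι : Type*} {x : ι → R} :
    IsUnimodular x ↔ ∀ P : Ideal R, P.IsPrime → ¬ ∀ i, x i ∈ P := by
  have hle (P : Ideal R) : Ideal.span (Set.range x) ≤ P ↔ ∀ i, x i ∈ P := by
    simp [Ideal.span_le, Set.range_subset_iff]
  refine ⟨fun hx P hP h => hP.ne_top (top_le_iff.1 (hx ▸ (hle P).2 h)), fun h => ?_⟩
  by_contra hne
  obtain ⟨P, hP, hxP⟩ := Ideal.exists_le_maximal _ hne
  exact h P hP.isPrime ((hle P).1 hxP)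

theorem isUnimodular_comp_some {r : ℕ} {b : OddIdx r → R} (hb : b ∈ oddIUm R r) :
    IsUnimodular (b ∘ some) := by
  refine isUnimodular_iff_forall_isPrime.2 fun P hP h =>
    isUnimodular_iff_forall_isPrime.1 hb.1 P hP ?_
  have hsq : b none ^ 2 ∈ P := by
    rw [eq_neg_of_add_eq_zero_left hb.2]
    exact neg_mem (sum_mem fun i _ => P.mul_mem_left _ (h _))
  rintro (_ | i)
  · exact P.mul_mem_left 2 (hP.mem_of_pow_mem 2 hsq)
  · exact h i

variable {r : ℕ} {u v : Fin r → R}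

theorem IsUnimodular.exists_dotProduct_add_eq_one (hx : IsUnimodular (Sum.elim u v)) (k : Fin r) :
    ∃ (c d : Fin r → R) (w : R), d k = 0 ∧ c ⬝ᵥ u + d ⬝ᵥ v + w * v k = 1 := by
  have hone : (1 : R) ∈ Ideal.span (Set.range (Sum.elim u v)) := hx ▸ Submodule.mem_top
  obtain ⟨c, hc⟩ := Ideal.mem_span_range_iff_exists_fun.1 hone
  refine ⟨c ∘ Sum.inl, c ∘ Sum.inr - Pi.single k (c (Sum.inr k)), c (Sum.inr k), by simp, ?_⟩
  rw [← hc, Fintype.sum_sum_type, sub_dotProduct, single_dotProduct, add_assoc, sub_add_cancel]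
  rfl

end Unimodular

section Reduction

variable {A : Type*} [CommRing A] {r : ℕ}

theorem dotProduct_mem {ι : Type*} [Fintype ι] {I : Ideal A} {u : ι → A} (hu : ∀ i, u i ∈ I)
    (t : ι → A) : t ⬝ᵥ u ∈ I :=
  sum_mem fun i _ => I.mul_mem_left (t i) (hu i)

theorem exists_dotProduct_eq_of_mem_span_image_compl {ι : Type*} [Fintype ι] {u : ι → A} {k : ι}
    {a : A} (ha : a ∈ Ideal.span (u '' {k}ᶜ)) : ∃ t : ι → A, t k = 0 ∧ t ⬝ᵥ u = a := by
  obtain ⟨t, ht, rfl⟩ := (Finsupp.mem_span_image_iff_linearCombination A).1 ha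
  exact ⟨t, Finsupp.notMem_support_iff.1 fun hk => ht hk rfl,
    by simp [Finsupp.linearCombination_apply, Finsupp.sum_fintype, dotProduct]⟩

theorem IsUnimodular.elim_add_smul_sub {u v : Fin r → A} (hx : IsUnimodular (Sum.elim u v))
    (k : Fin r) (t : Fin r → A) :
    IsUnimodular (Sum.elim (u + v k • t - Pi.single k (t ⬝ᵥ v)) v) := by
  refine isUnimodular_iff_forall_isPrime.2 fun P hP h => ?_
  have hv : ∀ i, v i ∈ P := fun i => h (Sum.inr i)
  refine isUnimodular_iff_forall_isPrime.1 hx P hP (Sum.forall.2 ⟨fun i => ?_, hv⟩)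
  have hdot : (Pi.single k (t ⬝ᵥ v) : Fin r → A) i ∈ P := by
    rcases eq_or_ne i k with rfl | hi
    · simpa using dotProduct_mem hv t
    · simp [hi]
  exact (Submodule.add_mem_iff_left P (P.mul_mem_right (t i) (hv k))).1
    ((Submodule.sub_mem_iff_left P hdot).1 (h (Sum.inl i)))

variable [IsNoetherianRing A]

theorem exists_forall_pred_le_height (k : Fin r) (a : Fin r → A) (s : A) :
    ∃ t : Fin r → A, t k = 0 ∧ ∀ P : Ideal A, P.IsPrime → (∀ i ≠ k, a i + s * t i ∈ P) → s ∉ P →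
      ((r - 1 : ℕ) : ℕ∞) ≤ P.height := by
  obtain ⟨t, ht0, ht⟩ := exists_forall_card_le_height (Finset.univ.erase k) a s
  exact ⟨t, ht0 k (by simp), by simpa using ht⟩

theorem exists_mem_evenOrbitLe_forall_le_height_of_notMem (k : Fin r) {u v : Fin r → A}
    (hx : IsUnimodular (Sum.elim u v)) :
    ∃ u', Sum.elim u' v ∈ evenOrbitLe (r - 1) (Sum.elim u v) ∧ IsUnimodular (Sum.elim u' v) ∧
      ∀ P : Ideal A, P.IsPrime → (∀ i ≠ k, u' i ∈ P) → v k ∉ P →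
        ((r - 1 : ℕ) : ℕ∞) ≤ P.height := by
  obtain ⟨t, htk, ht⟩ := exists_forall_pred_le_height k u (v k)
  exact ⟨_, elim_add_smul_sub_mem_evenOrbitLe htk u v, hx.elim_add_smul_sub k t,
    fun P hP hu => ht P hP fun i hi => by simpa [hi] using hu i hi⟩

theorem exists_mem_evenOrbitLe_forall_le_height_of_mem (k : Fin r) {u v : Fin r → A}
    (hx : IsUnimodular (Sum.elim u v))
    (huv : ∀ P : Ideal A, P.IsPrime → (∀ i ≠ k, u i ∈ P) → v k ∉ P →
      ((r - 1 : ℕ) : ℕ∞) ≤ P.height) :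
    ∃ u' v', Sum.elim u' v' ∈ evenOrbitLe (r - 1) (Sum.elim u v) ∧
      ∀ P : Ideal A, P.IsPrime → (∀ i ≠ k, u' i ∈ P) → v' k ∈ P →
        ((r - 1 : ℕ) : ℕ∞) ≤ P.height := by
  obtain ⟨c, d, w, hdk, hone⟩ := hx.exists_dotProduct_add_eq_one k
  obtain ⟨t, htk, ht⟩ := exists_forall_pred_le_height k (u - u k • d) (u k * u k)
  -- Modulo `u k` the entry `v k` becomes `v k + d ⬝ᵥ v`, and `d ⬝ᵥ v = 1` modulo `u` and `v k`.
  let s := u k • t - d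
  have hsk : s k = 0 := by simp [s, htk, hdk]
  refine ⟨_, _, elim_add_smul_mem_evenOrbitLe hsk u v, fun P hP hu' hv' => ?_⟩
  by_contra hheight
  have huk : u k ∈ P := by
    refine or_self_iff.1 (hP.mem_or_mem (not_not.1 fun h => hheight (ht P hP (fun i hi => ?_) h)))
    convert hu' i hi using 1
    simp [s]
    ring
  have hu : ∀ i, u i ∈ P := fun i => by
    rcases eq_or_ne i k with rfl | hi
    · exact huk
    · exact (Submodule.add_mem_iff_left P (P.mul_mem_right (s i) huk)).1 (hu' i hi)
  have hvk : v k ∈ P := not_not.1 fun h => hheight (huv P hP (fun i _ => hu i) h)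
  have hdv : d ⬝ᵥ v ∈ P := by
    have hsv : s ⬝ᵥ v ∈ P := by simpa using sub_mem hvk hv'
    have hd : d = u k • t - s := by simp [s]
    rw [hd, sub_dotProduct, smul_dotProduct]
    exact sub_mem (P.mul_mem_right _ huk) hsv
  exact hP.one_notMem (hone ▸ add_mem (add_mem (dotProduct_mem hu c) hdv) (P.mul_mem_left w hvk))

theorem exists_mem_evenOrbitLe_le_height_span (k : Fin r) {u v : Fin r → A}
    (hx : IsUnimodular (Sum.elim u v)) :
    ∃ u' v', Sum.elim u' v' ∈ evenOrbitLe (3 * (r - 1)) (Sum.elim u v) ∧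
      ((r - 1 : ℕ) : ℕ∞) ≤ (Ideal.span (u' '' {k}ᶜ)).height := by
  obtain ⟨u₁, h₁, hx₁, hP₁⟩ := exists_mem_evenOrbitLe_forall_le_height_of_notMem k hx
  obtain ⟨u₂, v₂, h₂, hP₂⟩ := exists_mem_evenOrbitLe_forall_le_height_of_mem k hx₁ hP₁
  obtain ⟨t, htk, ht⟩ := exists_forall_pred_le_height k u₂ (v₂ k)
  have h₃ := elim_add_smul_sub_mem_evenOrbitLe htk u₂ v₂
  rw [show 3 * (r - 1) = r - 1 + (r - 1) + (r - 1) by ring]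
  refine ⟨_, v₂, evenOrbitLe_trans (evenOrbitLe_trans h₁ h₂) h₃, ?_⟩
  rw [Ideal.height_eq_inf_minimalPrimes]
  refine le_iInf₂ fun P hP => ?_
  have hPrime : P.IsPrime := hP.1.1
  have hu : ∀ i ≠ k, u₂ i + v₂ k * t i ∈ P := fun i hi => by
    simpa [hi] using hP.1.2 (Ideal.subset_span ⟨i, hi, rfl⟩)
  by_cases hv : v₂ k ∈ P
  · exact hP₂ P hPrime (fun i hi =>
      (Submodule.add_mem_iff_left P (P.mul_mem_right (t i) hv)).1 (hu i hi)) hv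
  · exact ht P hPrime hu hv

theorem exists_mem_evenOrbitLe_isLexMonic {C : Type*} [CommRing C] [IsNoetherianRing C] {D n : ℕ}
    (hD : ringKrullDim C ≤ D) (hr : D + 2 ≤ r) (k : Fin r)
    {x : EvenIdx r → MvPolynomial (Fin n) C} (hx : IsUnimodular x) :
    ∃ y ∈ evenOrbitLe (4 * (r - 1)) x, IsLexMonic (y (Sum.inr k)) := by
  rw [show 4 * (r - 1) = 3 * (r - 1) + (r - 1) by ring]
  rw [← Sum.elim_comp_inl_inr x] at hx ⊢
  obtain ⟨u, v, huv, hheight⟩ := exists_mem_evenOrbitLe_le_height_span k hx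
  have hdim : ringKrullDim C < (Ideal.span (u '' {k}ᶜ)).height := by
    refine hD.trans_lt (lt_of_lt_of_le ?_ (WithBot.coe_le_coe.2 hheight))
    exact_mod_cast (by omega : D < r - 1)
  obtain ⟨f, hfI, hf⟩ := exists_isLexMonic_mem _ hdim
  obtain ⟨h, hI, hmonic⟩ := exists_add_monic hfI hf (v k)
  obtain ⟨t, htk, rfl⟩ := exists_dotProduct_eq_of_mem_span_image_compl hI
  have htk' : (-t) k = 0 := by simp [htk]
  refine ⟨_, evenOrbitLe_trans huv (elim_neg_add_smul_sub_mem_evenOrbitLe htk' u v), ?_⟩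
  simpa [htk, IsLexMonic] using hmonic

end Reduction

section MiddleExtension

variable {R : Type*} [CommRing R] {r : ℕ}

/-- The embedding of the even into the odd orthogonal group by which a matrix of size `2r` acts on
the columns of height `2r + 1` fixing the middle entry. -/
def middleExtension :
    Matrix (EvenIdx r) (EvenIdx r) R →* Matrix (OddIdx r) (OddIdx r) R where
  toFun g := Matrix.of fun
    | none, none => 1
    | some i, some j => g i j
    | _, _ => 0
  map_one' := by ext (_ | i) (_ | j) <;> simp [Matrix.one_apply]
  map_mul' g h := by ext (_ | i) (_ | j) <;> simp [Matrix.mul_apply]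

theorem middleExtension_mulVec_some (g : Matrix (EvenIdx r) (EvenIdx r) R) (x : OddIdx r → R)
    (i : EvenIdx r) : (middleExtension g *ᵥ x) (some i) = (g *ᵥ (x ∘ some)) i := by
  simp [middleExtension, Matrix.mulVec, dotProduct]

theorem middleExtension_evenT (i j : EvenIdx r) (ξ : R) :
    middleExtension (evenT i j ξ) = oddLongT i j ξ := by
  ext (_ | m) (_ | l) <;>
    simp [middleExtension, evenT, oddLongT, Matrix.one_apply, Matrix.single_apply]

theorem middleExtension_mem_oddEOLe {N : ℕ} {g : Matrix (EvenIdx r) (EvenIdx r) R}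
    (hg : g ∈ evenEOLe R r N) : middleExtension g ∈ oddEOLe R r N := by
  obtain ⟨l, hl, hlT, rfl⟩ := hg
  refine ⟨l.map middleExtension, by simpa using hl, ?_, map_list_prod _ l⟩
  simp only [List.forall_mem_map]
  intro t ht
  obtain ⟨i, j, ξ, hij, hij', rfl⟩ := hlT t ht
  exact Or.inl ⟨i, j, ξ, hij, hij', middleExtension_evenT i j ξ⟩

end MiddleExtension

end SplitOrthogonal

open SplitOrthogonal in
theorem proposition1_general {C : Type*} [CommRing C] [IsNoetherianRing C] (D n r : ℕ)
    (hD : ringKrullDim C ≤ (D : WithBot ℕ∞)) (hr : D + 2 ≤ r) (k : Fin r) :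
    (∀ b : EvenIdx r → MvPolynomial (Fin n) C, IsUnimodular b →
      ∃ b' ∈ (fun g => g *ᵥ b) '' evenEOLe (MvPolynomial (Fin n) C) r (4 * (r - 1)),
        IsLexMonic (b' (Sum.inr k))) ∧
    (∀ b : OddIdx r → MvPolynomial (Fin n) C, IsUnimodular (b ∘ some) →
      ∃ b' ∈ (fun g => g *ᵥ b) '' oddEOLe (MvPolynomial (Fin n) C) r (4 * (r - 1)),
        IsLexMonic (b' (some (Sum.inr k)))) := by
  refine ⟨fun b hb => exists_mem_evenOrbitLe_isLexMonic hD hr k hb, fun b hb => ?_⟩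
  obtain ⟨_, ⟨g, hg, rfl⟩, hmonic⟩ := exists_mem_evenOrbitLe_isLexMonic hD hr k hb
  refine ⟨_, ⟨_, middleExtension_mem_oddEOLe hg, rfl⟩, ?_⟩
  simpa only [middleExtension_mulVec_some] using hmonic

open SplitOrthogonal in
theorem proposition1 {C : Type*} [CommRing C] [IsNoetherianRing C] (D n r : ℕ)
    (hD : ringKrullDim C ≤ (D : WithBot ℕ∞)) (hr : max 3 (D + 2) ≤ r) :
    (∀ b ∈ evenIUm (MvPolynomial (Fin n) C) r,
      ∃ b' ∈ (fun g => g *ᵥ b) '' evenEOLe (MvPolynomial (Fin n) C) r (11 * r - 7),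
        IsLexMonic (b' (minus 2 (by omega)))) ∧
    (∀ b ∈ oddIUm (MvPolynomial (Fin n) C) r,
      ∃ b' ∈ (fun g => g *ᵥ b) '' oddEOLe (MvPolynomial (Fin n) C) r (12 * r - 8),
        IsLexMonic (b' (some (minus 2 (by omega))))) := by
  obtain ⟨heven, hodd⟩ := proposition1_general D n r hD (by omega) ⟨1, by omega⟩
  refine ⟨fun b hb => ?_, fun b hb => ?_⟩
  · obtain ⟨b', hb', hmonic⟩ := heven b hb.1
    exact ⟨b', Set.image_mono (evenEOLe_mono (by omega)) hb', hmonic⟩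
  · obtain ⟨b', hb', hmonic⟩ := hodd b (isUnimodular_comp_some hb)
    exact ⟨b', Set.image_mono (oddEOLe_mono (by omega)) hb', hmonic⟩
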